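/- Let $k\ge 1$ and $n\ge 2$ be integers. There are constants $C_{\mathrm{supp}}(k,n)>0$ and $C(k,n)>0$, depending only on $k$ and $n$, such that the following holds for all $\Omega>0$ and $\sigma>0$. Write $B_r^k(\mathbf x)$ for the open Euclidean ball in $\mathbb R^k$ of radius $r$ about $\mathbf x$. Let $\mu=\sum_{j=1}^n a_j\delta_{\mathbf y_j}$ with $a_j>0$ and distinct $\mathbf y_j\in B^k_{\frac{(n-1)\pi}{2\Omega}}(\mathbf 0)\subset\mathbb R^k$. For $\rho=\sum_j c_j\delta_{\mathbf x_j}$ put $\mathcal F\rho(\boldsymbol\omega)=\sum_j c_je^{i\mathbf x_j\cdot\boldsymbol\omega}$, and put $$m_{\min}=\min_{1\le j\le n}a_j,\qquad d_{\min}=\min_{p\ne j}\|\mathbf y_p-\mathbf y_j\|_2,\qquad \mathrm{SRF}=\frac{\pi}{\Omega\, d_{\min}}.$$ Let $\mathbf Y=\mathcal F\mu+\mathbf W$ be a measurement of $\mu$ with noise satisfying $|\mathbf W(\boldsymbol\omega)|<\sigma$ for all $\|\boldsymbol\omega\|_2\le\Omega$, and assume the separation condition $$d_{\min}\ \ge\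 \frac{C_{\mathrm{supp}}(k,n)}{\Omega}\Big(\frac{\sigma}{m_{\min}}\Big)^{\frac1{2n-1}}.$$ Let $\hat\mu=\sum_{j=1}^n\hat a_j\delta_{\hat{\mathbf y}_j}$, with $\hat a_j>0$ and $\hat{\mathbf y}_j\in B^k_{\frac{(n-1)\pi}{2\Omega}}(\mathbf 0)$, be any positive $\sigma$-admissible measure of $\mathbf Y$, that is, $|\mathcal F\hat\mu(\boldsymbol\omega)-\mathbf Y(\boldsymbol\omega)|<\sigma$ for all $\|\boldsymbol\omega\|_2\le\Omega$. Then $\hat\mu$ is within the $\frac{d_{\min}}2$-neighborhood of $\mu$: the balls $B^k_{d_{\min}/2}(\mathbf y_p)$, $1\le p\le n$, are pairwise disjoint and each $\hat{\mathbf y}_j$ lies in exactly one of them. Moreover, after reordering the $\hat{\mathbf y}_j$'s, we have $\hat{\mathbf y}_j\in B^k_{d_{\min}/2}(\mathbf y_j)$ and $$\|\hat{\mathbf y}_j-\mathbf y_j\|_2\ \le\ \frac{C(k,n)}{\Omega}\,\mathrm{SRF}^{2n-2}\,\frac{\sigma}{m_{\min}},\qquad 1\le j\le n.$$ -/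

import Mathlib

open MeasureTheory

/-- A positive discrete measure `∑ j, a_j δ_{y_j}` on `ℝ^k`, written with `n` point sources with
amplitudes `a_j > 0` and locations `y_j` (the locations are not required to be distinct here). -/
structure PosDiscreteMeasure (k n : ℕ) where
  /-- The amplitudes `a_j`. -/
  amp : Fin n → ℝ
  /-- The locations `y_j`. -/
  loc : Fin n → EuclideanSpace ℝ (Fin k)
  amp_pos : ∀ j, 0 < amp j

namespace PosDiscreteMeasure

variable {k n m : ℕ}

/-- The Borel measure `∑ j, a_j δ_{y_j}`. -/
noncomputable def toMeasure (μ : PosDiscreteMeasure k n) :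
    Measure (EuclideanSpace ℝ (Fin k)) :=
  ∑ j, ENNReal.ofReal (μ.amp j) • Measure.dirac (μ.loc j)

/-- The Fourier transform `ω ↦ ∑ j, a_j exp (i y_j · ω)`. -/
noncomputable def fourier (μ : PosDiscreteMeasure k n) (ω : EuclideanSpace ℝ (Fin k)) : ℂ :=
  ∑ j, (μ.amp j : ℂ) * Complex.exp (Complex.I * ((inner ℝ (μ.loc j) ω : ℝ) : ℂ))

/-- The sum above is the integral of `exp (i y · ω)` against the measure. -/
theorem fourier_eq_charFun (μ : PosDiscreteMeasure k n) (ω : EuclideanSpace ℝ (Fin k)) :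
    μ.fourier ω = charFun μ.toMeasure ω := by
  unfold fourier toMeasure
  rw [charFun_apply, integral_finsetSum_measure]
  · refine Finset.sum_congr rfl fun j _ => ?_
    rw [integral_smul_measure, integral_dirac, ENNReal.toReal_ofReal (μ.amp_pos j).le,
      Complex.real_smul, mul_comm Complex.I]
  · intro j _
    exact (integrable_dirac (by simp)).smul_measure ENNReal.ofReal_ne_top

/-- The smallest amplitude (a minimum over a finite set, nonempty for `n ≥ 1`). -/
noncomputable def mMin (μ : PosDiscreteMeasure k n) : ℝ :=
  ⨅ j, μ.amp j

/-- The minimal separation `min_{p ≠ j} ‖y_p - y_j‖₂` (a minimum over a finite set, nonempty for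
`n ≥ 2`). It is positive exactly when the locations are distinct. -/
noncomputable def dMin (μ : PosDiscreteMeasure k n) : ℝ :=
  ⨅ q : {q : Fin n × Fin n // q.1 ≠ q.2}, ‖μ.loc q.1.1 - μ.loc q.1.2‖

/-- All locations lie in the open ball of radius `(n - 1) π / (2 Ω)` about the origin. -/
def SupportedInBall (μ : PosDiscreteMeasure k n) (Ω : ℝ) : Prop :=
  ∀ j, μ.loc j ∈ Metric.ball (0 : EuclideanSpace ℝ (Fin k)) (((n : ℝ) - 1) * Real.pi / (2 * Ω))

/-- `Y` is a measurement generated by `μ`: its Fourier data plus a noise `W` which is smaller than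
the noise level `σ` at all frequencies up to the cutoff `Ω`. -/
def IsMeasurement (μ : PosDiscreteMeasure k n) (Ω σ : ℝ)
    (Y : EuclideanSpace ℝ (Fin k) → ℂ) : Prop :=
  ∃ W : EuclideanSpace ℝ (Fin k) → ℂ,
    (∀ ω, Y ω = μ.fourier ω + W ω) ∧ ∀ ω, ‖ω‖ ≤ Ω → ‖W ω‖ < σ

/-- `ν` is a positive `σ`-admissible discrete measure of the measurement `Y`. -/
def IsAdmissible (ν : PosDiscreteMeasure k m) (Ω σ : ℝ)
    (Y : EuclideanSpace ℝ (Fin k) → ℂ) : Prop :=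
  ∀ ω, ‖ω‖ ≤ Ω → ‖ν.fourier ω - Y ω‖ < σ

/-- `ν` is within the `δ`-neighborhood of `μ`: the open balls of radius `δ > 0` about the locations
of `μ` are pairwise disjoint, and each location of `ν` lies in one and only one of them. -/
def WithinNeighborhood (ν μ : PosDiscreteMeasure k n) (δ : ℝ) : Prop :=
  0 < δ ∧
  (∀ p j, p ≠ j → Disjoint (Metric.ball (μ.loc p) δ) (Metric.ball (μ.loc j) δ)) ∧
  ∀ j, ∃! p, ν.loc j ∈ Metric.ball (μ.loc p) δ

/-- The super-resolution factor: the Rayleigh limit `π / Ω` over the minimal separation. -/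
noncomputable def SRF (μ : PosDiscreteMeasure k n) (Ω : ℝ) : ℝ :=
  Real.pi / (Ω * μ.dMin)

end PosDiscreteMeasure

/-! The difference of the two Fourier transforms is an exponential sum with `2 * n` nodes, at most
`2 * σ` on the ball of radius `Ω`. All nodes but one location `y` of `μ` are annihilated, each by a
shift of the frequency along its difference with `y`; this works in any dimension. What survives
bounds the product of the `2 * n - 1` distances from `y` to the other nodes (`prod_norm_sub_le`). If
no location of `ν` were within `dMin / 2` of `y`, all these distances would be at least `dMin / 2`,
against the separation condition. So each ball captures a location of `ν`, by counting exactly one,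
and dividing out the other `2 * n - 2` distances bounds its error. -/

open Finset in
/-- If an exponential sum is at most `ε` on the ball of radius `Ω`, multiplying its amplitudes by
`r` factors `exp (i z · v) - exp (i x · v)`, which only use frequencies in that ball, yields a sum
of size at most `2 ^ r * ε`. -/
theorem norm_expSum_mul_prod_le {E ι κ : Type*} [NormedAddCommGroup E] [InnerProductSpace ℝ E]
    [Fintype ι] [DecidableEq κ] (c : ι → ℂ) (z : ι → E) {Ω ε : ℝ}
    (h : ∀ ω : E, ‖ω‖ ≤ Ω →
      ‖∑ j, c j * Complex.exp (Complex.I * ((inner ℝ (z j) ω : ℝ) : ℂ))‖ ≤ ε)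
    (x v : κ → E) (s : Finset κ) (ω : E) (hω : ‖ω‖ + ∑ i ∈ s, ‖v i‖ ≤ Ω) :
    ‖∑ j, c j * Complex.exp (Complex.I * ((inner ℝ (z j) ω : ℝ) : ℂ)) *
      ∏ i ∈ s, (Complex.exp (Complex.I * ((inner ℝ (z j) (v i) : ℝ) : ℂ)) -
        Complex.exp (Complex.I * ((inner ℝ (x i) (v i) : ℝ) : ℂ)))‖ ≤ 2 ^ #s * ε := by
  induction s using Finset.induction_on generalizing ω with
  | empty => simpa using h ω (by simpa using hω)
  | insert a s ha ih =>
    rw [sum_insert ha] at hω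
    have h1 := ih (ω + v a) (by linarith [norm_add_le ω (v a)])
    have h2 := ih ω (by linarith [norm_nonneg (v a)])
    have hu : ‖Complex.exp (Complex.I * ((inner ℝ (x a) (v a) : ℝ) : ℂ))‖ = 1 := by
      rw [mul_comm, Complex.norm_exp_ofReal_mul_I]
    set F : E → ℂ := fun w => ∑ j, c j * Complex.exp (Complex.I * ((inner ℝ (z j) w : ℝ) : ℂ)) *
      ∏ i ∈ s, (Complex.exp (Complex.I * ((inner ℝ (z j) (v i) : ℝ) : ℂ)) -
        Complex.exp (Complex.I * ((inner ℝ (x i) (v i) : ℝ) : ℂ))) with hF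
    -- A new factor is a shift by `v a` minus a unimodular multiple of the sum: it doubles the bound
    -- and costs `‖v a‖` of bandwidth.
    have key : ∑ j, c j * Complex.exp (Complex.I * ((inner ℝ (z j) ω : ℝ) : ℂ)) *
        ∏ i ∈ insert a s, (Complex.exp (Complex.I * ((inner ℝ (z j) (v i) : ℝ) : ℂ)) -
          Complex.exp (Complex.I * ((inner ℝ (x i) (v i) : ℝ) : ℂ))) =
        F (ω + v a) - Complex.exp (Complex.I * ((inner ℝ (x a) (v a) : ℝ) : ℂ)) * F ω := by
      simp only [hF]
      rw [mul_sum, ← sum_sub_distrib]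
      refine sum_congr rfl fun j _ => ?_
      rw [prod_insert ha, inner_add_right, Complex.ofReal_add, mul_add, Complex.exp_add]
      ring
    rw [key, card_insert_of_notMem ha, pow_succ]
    refine (norm_sub_le _ _).trans ?_
    rw [norm_mul, hu]
    linarith

/-- Two points of the unit circle at angular distance at most `π` are at least `2 / π` times that
distance apart. -/
theorem mul_abs_sub_le_norm_exp_sub_exp {α β : ℝ} (h : |α - β| ≤ Real.pi) :
    2 / Real.pi * |α - β| ≤
      ‖Complex.exp (Complex.I * (α : ℂ)) - Complex.exp (Complex.I * (β : ℂ))‖ := by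
  have e : Complex.exp (Complex.I * (α : ℂ)) - Complex.exp (Complex.I * (β : ℂ)) =
      Complex.exp (Complex.I * (β : ℂ)) * (Complex.exp (Complex.I * ((α - β : ℝ) : ℂ)) - 1) := by
    rw [mul_sub, ← Complex.exp_add, mul_one]
    push_cast
    ring_nf
  have hu : ‖Complex.exp (Complex.I * (β : ℂ))‖ = 1 := by
    rw [mul_comm, Complex.norm_exp_ofReal_mul_I]
  rw [e, norm_mul, hu, one_mul, Complex.norm_exp_I_mul_ofReal_sub_one, norm_mul,
    Real.norm_eq_abs, Real.norm_eq_abs, abs_two]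
  have h2 : |(α - β) / 2| ≤ Real.pi / 2 := by
    rw [abs_div, abs_two]
    linarith
  have := Real.mul_abs_le_abs_sin h2
  rw [abs_div, abs_two] at this
  linarith

open Finset in
/-- If an exponential sum with nodes `z j` is at most `ε` on the ball of radius `Ω`, then every
amplitude times the product of the distances from its node to the others is `O(ε)`. -/
theorem norm_amp_mul_prod_norm_sub_le {E ι : Type*} [NormedAddCommGroup E] [InnerProductSpace ℝ E]
    [Fintype ι] [DecidableEq ι] (c : ι → ℂ) (z : ι → E) {Ω ε N : ℝ} (hΩ : 0 ≤ Ω) (hN : 0 < N)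
    (h : ∀ ω : E, ‖ω‖ ≤ Ω →
      ‖∑ j, c j * Complex.exp (Complex.I * ((inner ℝ (z j) ω : ℝ) : ℂ))‖ ≤ ε)
    (p : ι) (hcard : (#(univ.erase p) : ℝ) ≤ N)
    (hz : ∀ i, Ω / N * ‖z p - z i‖ ≤ Real.pi) :
    ‖c p‖ * ∏ i ∈ univ.erase p, (2 / Real.pi * (Ω / N) * ‖z p - z i‖) ≤
      2 ^ #(univ.erase p) * ε := by
  have hh : 0 ≤ Ω / N := by positivity
  -- This direction maximises the phase gap between nodes `p` and `i`; the length lets `N` shifts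
  -- fit in `Ω`. For coincident nodes `v i = 0`.
  set v : ι → E := fun i => (Ω / N) • (‖z p - z i‖⁻¹ • (z p - z i)) with hv
  have hvn : ∀ i, ‖v i‖ ≤ Ω / N := by
    intro i
    rw [hv]
    simp only [norm_smul, norm_inv, norm_norm, Real.norm_of_nonneg hh]
    calc Ω / N * (‖z p - z i‖⁻¹ * ‖z p - z i‖) ≤ Ω / N * 1 := by
          gcongr
          exact inv_mul_le_one
      _ = Ω / N := mul_one _
  have hinner : ∀ i, inner ℝ (z p) (v i) - inner ℝ (z i) (v i) = Ω / N * ‖z p - z i‖ := by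
    intro i
    rw [← inner_sub_left, hv]
    simp only [inner_smul_right, real_inner_self_eq_norm_sq]
    by_cases h0 : ‖z p - z i‖ = 0
    · simp [h0]
    · field_simp
  have hsum : ‖(0 : E)‖ + ∑ i ∈ univ.erase p, ‖v i‖ ≤ Ω := by
    rw [norm_zero, zero_add]
    calc ∑ i ∈ univ.erase p, ‖v i‖ ≤ ∑ i ∈ univ.erase p, Ω / N := sum_le_sum fun i _ => hvn i
      _ = #(univ.erase p) * (Ω / N) := by rw [sum_const, nsmul_eq_mul]
      _ ≤ N * (Ω / N) := by gcongr
      _ = Ω := by field_simp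
  have main := norm_expSum_mul_prod_le c z h z v (univ.erase p) 0 hsum
  rw [sum_eq_single p] at main
  · rw [norm_mul, norm_mul, norm_prod] at main
    simp only [inner_zero_right, Complex.ofReal_zero, mul_zero, Complex.exp_zero, norm_one,
      mul_one] at main
    refine le_trans ?_ main
    refine mul_le_mul_of_nonneg_left (prod_le_prod (fun i _ => ?_) fun i _ => ?_) (norm_nonneg _)
    · have := Real.pi_pos
      positivity
    · have hi := hinner i
      have habs : |inner ℝ (z p) (v i) - inner ℝ (z i) (v i)| = Ω / N * ‖z p - z i‖ := by
        rw [hi, abs_of_nonneg (by positivity)]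
      have := mul_abs_sub_le_norm_exp_sub_exp (habs.trans_le (hz i))
      rw [habs] at this
      rwa [mul_assoc]
  · intro j _ hj
    rw [prod_eq_zero (mem_erase.mpr ⟨hj, mem_univ j⟩) (sub_self _), mul_zero]
  · simp

namespace PosDiscreteMeasure

variable {k n : ℕ}

theorem mMin_le_amp (μ : PosDiscreteMeasure k n) (j : Fin n) : μ.mMin ≤ μ.amp j :=
  ciInf_le (Set.finite_range _).bddBelow j

theorem mMin_pos (μ : PosDiscreteMeasure k n) (hn : 0 < n) : 0 < μ.mMin := by
  have : Nonempty (Fin n) := ⟨⟨0, hn⟩⟩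
  obtain ⟨j, hj⟩ := exists_eq_ciInf_of_finite (f := μ.amp)
  rw [mMin, ← hj]
  exact μ.amp_pos j

theorem dMin_le_norm_sub (μ : PosDiscreteMeasure k n) {p q : Fin n} (h : p ≠ q) :
    μ.dMin ≤ ‖μ.loc p - μ.loc q‖ :=
  ciInf_le (f := fun q : {q : Fin n × Fin n // q.1 ≠ q.2} => ‖μ.loc q.1.1 - μ.loc q.1.2‖)
    (Set.finite_range _).bddBelow ⟨(p, q), h⟩

open Finset in
/-- Two measures with Fourier data close to each other: the product of the distances from a
location of `μ` to all other locations of `μ` and `ν` is small. -/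
theorem prod_norm_sub_le {μ ν : PosDiscreteMeasure k n} {Ω σ : ℝ} (hn : 0 < n) (hΩ : 0 < Ω)
    (hμ : μ.SupportedInBall Ω) (hν : ν.SupportedInBall Ω)
    (h : ∀ ω, ‖ω‖ ≤ Ω → ‖ν.fourier ω - μ.fourier ω‖ ≤ 2 * σ) (p : Fin n) :
    Ω ^ (2 * n - 1) * ∏ i ∈ univ.erase (Sum.inr p : Fin n ⊕ Fin n),
      ‖μ.loc p - Sum.elim ν.loc μ.loc i‖ ≤
      2 * (2 * Real.pi * n) ^ (2 * n - 1) * (σ / μ.mMin) := by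
  have hn' : (0 : ℝ) < n := by exact_mod_cast hn
  have hpi := Real.pi_pos
  have hm := μ.mMin_pos hn
  have hcard : #(univ.erase (Sum.inr p : Fin n ⊕ Fin n)) = 2 * n - 1 := by
    rw [card_erase_of_mem (mem_univ _), card_univ, Fintype.card_sum, Fintype.card_fin]
    omega
  have key := norm_amp_mul_prod_norm_sub_le (ε := 2 * σ) (N := 2 * n)
    (Sum.elim (fun j => (ν.amp j : ℂ)) (fun j => -(μ.amp j : ℂ)))
    (Sum.elim ν.loc μ.loc) hΩ.le (by positivity)
    (by
      intro ω hω
      have := h ω hω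
      rw [Fintype.sum_sum_type]
      simpa [fourier, sub_eq_add_neg] using this)
    (Sum.inr p)
    (by
      rw [hcard]
      exact_mod_cast Nat.sub_le _ _)
    (by
      intro i
      have hb : ∀ i, ‖Sum.elim ν.loc μ.loc i‖ ≤ ((n : ℝ) - 1) * Real.pi / (2 * Ω) := by
        rintro (j | j)
        · exact (mem_ball_zero_iff.mp (hν j)).le
        · exact (mem_ball_zero_iff.mp (hμ j)).le
      calc Ω / (2 * n) * ‖Sum.elim ν.loc μ.loc (Sum.inr p) - Sum.elim ν.loc μ.loc i‖
          ≤ Ω / (2 * n) * (n * Real.pi / (2 * Ω) + n * Real.pi / (2 * Ω)) := by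
            gcongr
            refine (norm_sub_le _ _).trans (add_le_add ((hb _).trans ?_) ((hb _).trans ?_)) <;>
            · gcongr
              linarith
        _ = Real.pi / 2 := by
            field_simp
            ring
        _ ≤ Real.pi := by linarith)
  rw [prod_mul_distrib, prod_const, hcard] at key
  simp only [Sum.elim_inr, norm_neg, Complex.norm_real, Real.norm_eq_abs,
    abs_of_pos (μ.amp_pos p)] at key
  set P := ∏ i ∈ univ.erase (Sum.inr p : Fin n ⊕ Fin n), ‖μ.loc p - Sum.elim ν.loc μ.loc i‖
  have hP : 0 ≤ P := prod_nonneg fun _ _ => norm_nonneg _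
  have hconst : 2 / Real.pi * (Ω / (2 * n)) = Ω / (Real.pi * n) := by field_simp
  rw [hconst, div_pow] at key
  have key2 : μ.mMin * (Ω ^ (2 * n - 1) / (Real.pi * n) ^ (2 * n - 1) * P) ≤
      2 ^ (2 * n - 1) * (2 * σ) :=
    (mul_le_mul_of_nonneg_right (μ.mMin_le_amp p) (by positivity)).trans key
  rw [show 2 * Real.pi * n = 2 * (Real.pi * n) by ring, mul_pow]
  set A := (Real.pi * (n : ℝ)) ^ (2 * n - 1)
  have hA : 0 < A := by positivity
  have e : μ.mMin * (Ω ^ (2 * n - 1) / A * P) = μ.mMin / A * (Ω ^ (2 * n - 1) * P) := by ring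
  rw [e] at key2
  calc Ω ^ (2 * n - 1) * P = A / μ.mMin * (μ.mMin / A * (Ω ^ (2 * n - 1) * P)) := by
        field_simp
    _ ≤ A / μ.mMin * (2 ^ (2 * n - 1) * (2 * σ)) := by gcongr
    _ = 2 * (2 ^ (2 * n - 1) * A) * (σ / μ.mMin) := by ring

end PosDiscreteMeasure

open Finset PosDiscreteMeasure in
theorem theorem3p3 (k n : ℕ) (hn : 2 ≤ n) :
    ∃ Csupp C : ℝ, 0 < Csupp ∧ 0 < C ∧
      ∀ (Ω σ : ℝ), 0 < Ω →
      ∀ (μ : PosDiscreteMeasure k n), μ.SupportedInBall Ω →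
      ∀ (Y : EuclideanSpace ℝ (Fin k) → ℂ), μ.IsMeasurement Ω σ Y →
        Csupp / Ω * (σ / μ.mMin) ^ (1 / (2 * (n : ℝ) - 1)) ≤ μ.dMin →
        ∀ (ν : PosDiscreteMeasure k n), ν.SupportedInBall Ω → ν.IsAdmissible Ω σ Y →
          ν.WithinNeighborhood μ (μ.dMin / 2) ∧
          ∃ e : Equiv.Perm (Fin n), ∀ j,
            ν.loc (e j) ∈ Metric.ball (μ.loc j) (μ.dMin / 2) ∧
            ‖ν.loc (e j) - μ.loc j‖ ≤ C / Ω * μ.SRF Ω ^ (2 * n - 2) * (σ / μ.mMin) := by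
  have hn0 : 0 < n := by omega
  have hn' : (0 : ℝ) < n := by exact_mod_cast hn0
  have hpi := Real.pi_pos
  -- `8 = 2 * 2 * 2`: beyond the `2 * π * n` of `prod_norm_sub_le`, one factor 2 halves `dMin` and
  -- another gives the contradiction. In the second constant, `2 / π` converts `1 / (Ω * dMin / 2)`
  -- to `SRF`.
  refine ⟨8 * Real.pi * n,
    2 * (2 * Real.pi * n) ^ (2 * n - 1) * (2 / Real.pi) ^ (2 * n - 2),
    by positivity, by positivity, ?_⟩
  rintro Ω σ hΩ μ hμ Y ⟨W, hYW, hW⟩ hsep ν hν hadm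
  have hσ : 0 < σ := (norm_nonneg _).trans_lt (hW 0 (by simpa using hΩ.le))
  have hm := μ.mMin_pos hn0
  have hs : 0 < σ / μ.mMin := by positivity
  -- Separation already forces the locations of `μ` to be distinct.
  have hd : 0 < μ.dMin := lt_of_lt_of_le (by positivity) hsep
  have hclose : ∀ ω, ‖ω‖ ≤ Ω → ‖ν.fourier ω - μ.fourier ω‖ ≤ 2 * σ := by
    intro ω hω
    have e : ν.fourier ω - μ.fourier ω = (ν.fourier ω - Y ω) + W ω := by
      rw [hYW]
      ring
    rw [e]
    linarith [norm_add_le (ν.fourier ω - Y ω) (W ω), hadm ω hω, hW ω hω]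
  have hprod := prod_norm_sub_le hn0 hΩ hμ hν hclose
  have hcard : ∀ p, #(univ.erase (Sum.inr p : Fin n ⊕ Fin n)) = 2 * n - 1 := by
    intro p
    rw [card_erase_of_mem (mem_univ _), card_univ, Fintype.card_sum, Fintype.card_fin]
    omega
  have hsep_pow : (8 * Real.pi * n) ^ (2 * n - 1) * (σ / μ.mMin) ≤
      (Ω * μ.dMin) ^ (2 * n - 1) := by
    have h1 : 8 * Real.pi * n * (σ / μ.mMin) ^ (1 / (2 * (n : ℝ) - 1)) ≤ Ω * μ.dMin := by
      rw [div_mul_eq_mul_div, div_le_iff₀ hΩ] at hsep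
      linarith
    have h2 := pow_le_pow_left₀ (by positivity) h1 (2 * n - 1)
    have hcast : (2 * (n : ℝ) - 1) = ((2 * n - 1 : ℕ) : ℝ) := by
      rw [Nat.cast_sub (by omega)]
      push_cast
      ring
    rwa [mul_pow, hcast, one_div, Real.rpow_inv_natCast_pow hs.le (by omega)] at h2
  have hdisj : ∀ p j, p ≠ j → Disjoint (Metric.ball (μ.loc p) (μ.dMin / 2))
      (Metric.ball (μ.loc j) (μ.dMin / 2)) := by
    intro p j hpj
    refine Metric.ball_disjoint_ball ?_
    rw [dist_eq_norm, add_halves]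
    exact μ.dMin_le_norm_sub hpj
  have hex : ∀ p, ∃ j, ν.loc j ∈ Metric.ball (μ.loc p) (μ.dMin / 2) := by
    intro p
    by_contra! hno
    have hlow : (μ.dMin / 2) ^ (2 * n - 1) ≤ ∏ i ∈ univ.erase (Sum.inr p : Fin n ⊕ Fin n),
        ‖μ.loc p - Sum.elim ν.loc μ.loc i‖ := by
      rw [← hcard p, ← prod_const]
      refine prod_le_prod (fun _ _ => by positivity) ?_
      rintro (j | q) hi
      · have := hno j
        rwa [Metric.mem_ball, not_lt, dist_comm, dist_eq_norm] at this
      · have hq : p ≠ q := by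
          rintro rfl
          simp at hi
        exact (half_le_self hd.le).trans (μ.dMin_le_norm_sub hq)
    have h1 : (Ω * (μ.dMin / 2)) ^ (2 * n - 1) ≤
        2 * (2 * Real.pi * n) ^ (2 * n - 1) * (σ / μ.mMin) := by
      rw [mul_pow]
      exact (mul_le_mul_of_nonneg_left hlow (by positivity)).trans (hprod p)
    have h2 : (2 : ℝ) ^ (2 * n - 1) * ((2 * Real.pi * n) ^ (2 * n - 1) * (σ / μ.mMin)) ≤
        2 * ((2 * Real.pi * n) ^ (2 * n - 1) * (σ / μ.mMin)) := by
      have e1 : (8 * Real.pi * n) ^ (2 * n - 1) =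
          2 ^ (2 * n - 1) * (2 ^ (2 * n - 1) * (2 * Real.pi * n) ^ (2 * n - 1)) := by
        rw [← mul_pow, ← mul_pow]
        ring
      have e2 : (Ω * μ.dMin) ^ (2 * n - 1) =
          2 ^ (2 * n - 1) * (Ω * (μ.dMin / 2)) ^ (2 * n - 1) := by
        rw [← mul_pow]
        ring
      rw [e1, e2, mul_assoc] at hsep_pow
      have := (le_of_mul_le_mul_left hsep_pow (by positivity)).trans h1
      linarith
    have h3 : (2 : ℝ) ^ (2 * n - 1) ≤ 2 := le_of_mul_le_mul_right h2 (by positivity)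
    -- Here `n ≥ 2` is essential: for `n = 1` the two sides of `h3` agree.
    have h4 : (2 : ℝ) ^ 2 ≤ 2 ^ (2 * n - 1) := pow_le_pow_right₀ (by norm_num) (by omega)
    linarith
  choose f hf using hex
  have hinj : Function.Injective f := by
    intro p q hpq
    by_contra hne
    exact Set.disjoint_left.mp (hdisj p q hne) (hf p) (hpq ▸ hf q)
  have hbij : Function.Bijective f := Finite.injective_iff_bijective.mp hinj
  refine ⟨⟨half_pos hd, hdisj, fun j => ?_⟩, Equiv.ofBijective f hbij, fun p => ⟨hf p, ?_⟩⟩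
  · obtain ⟨p, rfl⟩ := hbij.2 j
    refine ⟨p, hf p, fun q hq => ?_⟩
    by_contra hne
    exact Set.disjoint_left.mp (hdisj q p hne) hq (hf p)
  · rw [Equiv.ofBijective_apply, norm_sub_rev]
    have hmem : (Sum.inl (f p) : Fin n ⊕ Fin n) ∈ univ.erase (Sum.inr p) := by simp
    have hp := hprod p
    rw [← mul_prod_erase _ _ hmem, Sum.elim_inl] at hp
    have hlow : (μ.dMin / 2) ^ (2 * n - 2) ≤
        ∏ i ∈ (univ.erase (Sum.inr p : Fin n ⊕ Fin n)).erase (Sum.inl (f p)),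
          ‖μ.loc p - Sum.elim ν.loc μ.loc i‖ := by
      have hc : #((univ.erase (Sum.inr p : Fin n ⊕ Fin n)).erase (Sum.inl (f p))) =
          2 * n - 2 := by
        rw [card_erase_of_mem hmem, hcard]
        omega
      rw [← hc, ← prod_const]
      refine prod_le_prod (fun _ _ => by positivity) ?_
      rintro (j | q) hi
      · obtain ⟨q, rfl⟩ := hbij.2 j
        have hq : q ≠ p := by
          rintro rfl
          simp at hi
        -- The location `ν.loc (f q)` lies in the ball about `μ.loc q`, so not in the disjoint one
        -- about `μ.loc p`.
        by_contra! hlt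
        rw [← dist_eq_norm, dist_comm] at hlt
        exact Set.disjoint_left.mp (hdisj q p hq) (hf q) (Metric.mem_ball.mpr hlt)
      · have hq : p ≠ q := by
          rintro rfl
          simp at hi
        exact (half_le_self hd.le).trans (μ.dMin_le_norm_sub hq)
    have h1 : ‖μ.loc p - ν.loc (f p)‖ * (Ω ^ (2 * n - 1) * (μ.dMin / 2) ^ (2 * n - 2)) ≤
        2 * (2 * Real.pi * n) ^ (2 * n - 1) * (σ / μ.mMin) := by
      refine le_trans ?_ hp
      rw [mul_left_comm]
      gcongr
    rw [← le_div_iff₀ (by positivity)] at h1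
    refine h1.trans_eq ?_
    have e : Ω ^ (2 * n - 1) = Ω * Ω ^ (2 * n - 2) := by
      rw [← pow_succ']
      congr 1
      omega
    rw [SRF, e, div_pow, div_pow, div_pow, mul_pow Ω]
    field_simp
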